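/- **Definitions.** For $C>0$, a $C$-rough isometry $f:Y\to Z$ of metric spaces is a (not necessarily continuous) map with $-C+d(x,y)\le d(fx,fy)\le d(x,y)+C$ for all $x,y$. A metric space $Y$ is roughly geodesic if for some $C>0$ any two points are joined by a $C$-rough isometry from a compact interval, and a roughly geodesic ray is a map $\xi:[0,\infty)\to Y$ that is a $C$-rough isometry for some $C>0$. Put $(x|x')_y=\frac12\big(d(x,y)+d(y,x')-d(x,x')\big)$. $Y$ is Gromov hyperbolic if it is roughly geodesic and, for some $\delta\ge0$, $(x|x'')_y\ge\min\{(x|x')_y,(x'|x'')_y\}-\delta$ for all $x,x',x'',y\in Y$. The boundary $\partial_\infty Y$ is the set of roughly geodesic rays modulo being at bounded Hausdorff distance. Given a roughly geodesic ray $\eta$ and $a>1$, the parabolic visual quasimetric on $\partial_\infty Y\setminus\{[\eta]\}$ is $$d_{\eta,a}([\xi],[\zeta])=\lim_{t\to\infty}a^{\,t-(\xi(t)|\zeta(t))_{\eta(t)}},$$ provided that this limit exists and does not depend on the representatives $\xi,\zeta$. A metric $d$ on $\partial_\infty Y\setminus\{[\eta]\}$ is a parabolic visual metric if for some $a>1$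 the quasimetric $d_{\eta,a}$ is defined in this sense and there is $L\ge1$ with $L^{-1}d_{\eta,a}\le d\le L\,d_{\eta,a}$. For an unbounded metric space $(X,d_X)$ let $\mathrm{Con}(X)=X\times(0,\infty)$ with the metric $$d_{\mathrm{Con}(X)}\big((x,t),(x',t')\big)=2\log\frac{d_X(x,x')+\max\{t,t'\}}{\sqrt{tt'}}.$$ For $x,z\in X$ and $s\ge 0$ let $\gamma_x(s)=(x,e^{-s})$ and $\gamma_{\infty,z}(s)=(z,e^s)$; these are geodesic rays, and the vertical direction $[\gamma_\infty]=[\gamma_{\infty,z}]$ does not depend on $z$. Let $\iota:X\cup\{\infty\}\to\partial_\infty\mathrm{Con}(X)$ be given by $\iota(x)=[\gamma_x]$ and $\iota(\infty)=[\gamma_\infty]$. **Statement.** Let $(X,d_X)$ be an unbounded complete metric space, let $a>1$, and let $\alpha:X\to X$ be a bijection with $d_X(\alpha x,\alpha y)=a\,d_X(x,y)$ for all $x,y\in X$. Suppose that $K\subset X$ is compact with $\bigcup_{n\in\mathbb Z}\alpha^nK=X$, and that $\alpha$ fixes a point $x_0$ in the interior of $K$. Then $\mathrm{Con}(X)$ is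 Gromov hyperbolic, $\iota$ is a bijection (so it restricts to a bijection $X\to\partial_\infty\mathrm{Con}(X)\setminus\{[\gamma_\infty]\}$), and the metric $d_X$, transported by this restricted bijection, is a parabolic visual metric on $\partial_\infty\mathrm{Con}(X)\setminus\{[\gamma_\infty]\}$, with $\eta=\gamma_{\infty,z}$ for every $z\in X$. -/

import Mathlib

open Set Filter Topology
open scoped NNReal

noncomputable section

/-! ### Rough isometries, rough geodesics, Gromov hyperbolicity -/

/-- A `C`-rough isometry between metric spaces (not necessarily continuous). -/
def IsRoughIsometry {Y Z : Type*} [MetricSpace Y] [MetricSpace Z] (C : ℝ) (f : Y → Z) : Prop :=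
  ∀ x y : Y, -C + dist x y ≤ dist (f x) (f y) ∧ dist (f x) (f y) ≤ dist x y + C

/-- Any two points are joined by a `C`-rough geodesic, i.e. by a `C`-rough isometry from a compact
interval `[0, ℓ]`, with one and the same constant `C > 0`. -/
def IsRoughlyGeodesic (Y : Type*) [MetricSpace Y] : Prop :=
  ∃ C : ℝ, 0 < C ∧ ∀ x y : Y, ∃ (ℓ : ℝ) (hl : 0 ≤ ℓ) (f : Icc (0 : ℝ) ℓ → Y),
    IsRoughIsometry C f ∧ f ⟨0, left_mem_Icc.2 hl⟩ = x ∧ f ⟨ℓ, right_mem_Icc.2 hl⟩ = y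

/-- The Gromov product `(x | x')_y`. -/
def gromovProduct {Y : Type*} [MetricSpace Y] (x x' y : Y) : ℝ :=
  (dist x y + dist y x' - dist x x') / 2

/-- A roughly geodesic space is Gromov hyperbolic if it is `δ`-hyperbolic for some `δ ≥ 0`. -/
def IsGromovHyperbolic (Y : Type*) [MetricSpace Y] : Prop :=
  IsRoughlyGeodesic Y ∧ ∃ δ : ℝ, 0 ≤ δ ∧ ∀ x x' x'' y : Y,
    min (gromovProduct x x' y) (gromovProduct x' x'' y) - δ ≤ gromovProduct x x'' y

/-! ### The boundary at infinity -/

/-- A roughly geodesic ray: a `C`-rough isometry from `[0, ∞)`, for some `C > 0`. -/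
structure RoughRay (Y : Type*) [MetricSpace Y] where
  toFun : ℝ≥0 → Y
  rough : ∃ C : ℝ, 0 < C ∧ IsRoughIsometry C toFun

instance (Y : Type*) [MetricSpace Y] : CoeFun (RoughRay Y) (fun _ => ℝ≥0 → Y) :=
  ⟨RoughRay.toFun⟩

/-- Two rays are equivalent if (their images) are at bounded Hausdorff distance. -/
instance roughRaySetoid (Y : Type*) [MetricSpace Y] : Setoid (RoughRay Y) where
  r ξ ζ := Metric.hausdorffEDist (range ξ) (range ζ) < ⊤
  iseqv :=
    { refl := fun ξ => by simp
      symm := fun {ξ ζ} h => by rwa [Metric.hausdorffEDist_comm]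
      trans := fun {ξ ζ θ} h1 h2 =>
        lt_of_le_of_lt Metric.hausdorffEDist_triangle (ENNReal.add_lt_top.2 ⟨h1, h2⟩) }

/-- The boundary at infinity `∂_∞ Y`. -/
def BoundaryAtInfinity (Y : Type*) [MetricSpace Y] : Type _ :=
  Quotient (roughRaySetoid Y)

/-- The boundary point `[ξ]` represented by a ray `ξ`. -/
def RoughRay.endpoint {Y : Type*} [MetricSpace Y] (ξ : RoughRay Y) : BoundaryAtInfinity Y :=
  Quotient.mk (roughRaySetoid Y) ξ

/-- The punctured boundary `∂_∞ Y ∖ {[η]}`. -/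
abbrev PuncturedBoundary {Y : Type*} [MetricSpace Y] (η : RoughRay Y) : Type _ :=
  {p : BoundaryAtInfinity Y // p ≠ η.endpoint}

/-! ### Parabolic visual metrics -/

/-- `q` is the parabolic visual quasimetric with base `a` of the ray `η`:
`q([ξ], [ζ]) = lim_{t → ∞} a ^ (t - (ξ(t) | ζ(t))_{η(t)})`, where the limit is required to exist,
with the same value, for all rays `ξ`, `ζ` representing the two boundary points. -/
def IsParabolicVisualQuasimetric {Y : Type*} [MetricSpace Y] (η : RoughRay Y) (a : ℝ)
    (q : PuncturedBoundary η → PuncturedBoundary η → ℝ) : Prop :=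
  ∀ (ξ ζ : RoughRay Y) (hξ : ξ.endpoint ≠ η.endpoint) (hζ : ζ.endpoint ≠ η.endpoint),
    Tendsto (fun t : ℝ≥0 => a ^ ((t : ℝ) - gromovProduct (ξ t) (ζ t) (η t))) atTop
      (𝓝 (q ⟨ξ.endpoint, hξ⟩ ⟨ζ.endpoint, hζ⟩))

/-- A metric on `∂_∞ Y ∖ {[η]}` is a parabolic visual metric if it is bi-Lipschitz to the parabolic
visual quasimetric of `η` with base `a`, for some `a > 1`. -/
def IsParabolicVisualMetric {Y : Type*} [MetricSpace Y] (η : RoughRay Y)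
    (m : MetricSpace (PuncturedBoundary η)) : Prop :=
  ∃ a : ℝ, 1 < a ∧ ∃ q : PuncturedBoundary η → PuncturedBoundary η → ℝ,
    IsParabolicVisualQuasimetric η a q ∧
    ∃ L : ℝ, 1 ≤ L ∧ ∀ u v : PuncturedBoundary η,
      L⁻¹ * q u v ≤ m.dist u v ∧ m.dist u v ≤ L * q u v

/-! ### The hyperbolic cone -/

/-- The set `Con(X) = X × (0, D]` (`X × (0, ∞)` if `D = ∞`), where `D` is the diameter of `X`. -/
@[ext] structure HypCone (X : Type*) [MetricSpace X] where
  base : X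
  height : ℝ
  height_pos : 0 < height
  height_le : ENNReal.ofReal height ≤ Metric.ediam (univ : Set X)

namespace HypCone

variable {X : Type*} [MetricSpace X]

/-- The distance of `Con(X)`. -/
def conDist (p q : HypCone X) : ℝ :=
  2 * Real.log ((dist p.base q.base + max p.height q.height) / √(p.height * q.height))

theorem conDist_eq (p q : HypCone X) :
    conDist p q = 2 * Real.log (dist p.base q.base + max p.height q.height)
      - Real.log p.height - Real.log q.height := by
  have hp := p.height_pos
  have hq := q.height_pos
  have h1 : 0 < dist p.base q.base + max p.height q.height :=
    add_pos_of_nonneg_of_pos dist_nonneg (lt_max_of_lt_left hp)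
  rw [conDist, Real.log_div h1.ne' (Real.sqrt_pos.2 (mul_pos hp hq)).ne',
    Real.log_sqrt (mul_pos hp hq).le, Real.log_mul hp.ne' hq.ne']
  ring

theorem conDist_self (p : HypCone X) : conDist p p = 0 := by
  rw [conDist_eq]; simp; ring

theorem conDist_comm (p q : HypCone X) : conDist p q = conDist q p := by
  rw [conDist_eq, conDist_eq, dist_comm, max_comm]; ring

theorem conDist_triangle (p q r : HypCone X) : conDist p r ≤ conDist p q + conDist q r := by
  simp only [conDist_eq]
  have hp := p.height_pos
  have hq := q.height_pos
  have hr := r.height_pos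
  have hpos : ∀ u v : HypCone X, 0 < dist u.base v.base + max u.height v.height := fun u v =>
    add_pos_of_nonneg_of_pos dist_nonneg (lt_max_of_lt_left u.height_pos)
  have key : (dist p.base r.base + max p.height r.height) * q.height ≤
      (dist p.base q.base + max p.height q.height) *
        (dist q.base r.base + max q.height r.height) := by
    have ht := dist_triangle p.base q.base r.base
    have hA : 0 ≤ dist p.base q.base := dist_nonneg
    have hB : 0 ≤ dist q.base r.base := dist_nonneg
    have hM := le_max_right p.height q.height
    have hM' := le_max_left p.height q.height
    have hN := le_max_left q.height r.height
    have hN' := le_max_right q.height r.height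
    have hmul : max p.height r.height * q.height ≤
        max p.height q.height * max q.height r.height := by
      rcases max_cases p.height r.height with h | h <;> rw [h.1]
      · exact mul_le_mul hM' hN hq.le (hp.le.trans hM')
      · rw [mul_comm]; exact mul_le_mul hM hN' hr.le (hp.le.trans hM')
    nlinarith [mul_nonneg hA hB, mul_le_mul_of_nonneg_left hN hA,
      mul_le_mul_of_nonneg_left hM hB, mul_le_mul_of_nonneg_right ht hq.le]
  have hlog := Real.log_le_log (mul_pos (hpos p r) hq) key
  rw [Real.log_mul (hpos p r).ne' hq.ne', Real.log_mul (hpos p q).ne' (hpos q r).ne'] at hlog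
  linarith

theorem eq_of_conDist_eq_zero {p q : HypCone X} (h : conDist p q = 0) : p = q := by
  have hp := p.height_pos
  have hq := q.height_pos
  have h1 : 0 < dist p.base q.base + max p.height q.height :=
    add_pos_of_nonneg_of_pos dist_nonneg (lt_max_of_lt_left hp)
  have hd : 0 ≤ dist p.base q.base := dist_nonneg
  have h2 : (dist p.base q.base + max p.height q.height) ^ 2 = p.height * q.height := by
    apply Real.log_injOn_pos (mem_Ioi.2 (pow_pos h1 2)) (mem_Ioi.2 (mul_pos hp hq))
    rw [conDist_eq] at h
    rw [Real.log_pow, Real.log_mul hp.ne' hq.ne']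
    push_cast
    linarith
  have hM := le_max_left p.height q.height
  have hN := le_max_right p.height q.height
  have h3 : dist p.base q.base = 0 := by nlinarith
  have h4 : p.height = q.height := by
    rw [h3] at h2
    rcases max_cases p.height q.height with h' | h' <;> rw [h'.1] at h2 <;> nlinarith
  exact HypCone.ext (dist_eq_zero.1 h3) h4

instance : MetricSpace (HypCone X) where
  dist := conDist
  dist_self := conDist_self
  dist_comm := conDist_comm
  dist_triangle := conDist_triangle
  eq_of_dist_eq_zero := eq_of_conDist_eq_zero

theorem dist_def (p q : HypCone X) :
    dist p q =
      2 * Real.log ((dist p.base q.base + max p.height q.height) / √(p.height * q.height)) := rfl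

theorem dist_eq (p q : HypCone X) :
    dist p q = 2 * Real.log (dist p.base q.base + max p.height q.height)
      - Real.log p.height - Real.log q.height := conDist_eq p q

/-- The point `(x, t)` of `Con(X)`, for `X` unbounded. -/
def mk' (hX : ¬ Bornology.IsBounded (univ : Set X)) (x : X) (t : ℝ) (ht : 0 < t) : HypCone X where
  base := x
  height := t
  height_pos := ht
  height_le := by
    have h : Metric.ediam (univ : Set X) = ⊤ := by
      by_contra h
      exact hX (Metric.isBounded_iff_ediam_ne_top.2 h)
    rw [h]
    exact le_top

/-- The downward ray `γ_x(s) = (x, e^{-s})`. -/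
def downRay (hX : ¬ Bornology.IsBounded (univ : Set X)) (x : X) : RoughRay (HypCone X) where
  toFun s := mk' hX x (Real.exp (-(s : ℝ))) (Real.exp_pos _)
  rough := by
    have h : ∀ s t : ℝ≥0, dist (mk' hX x (Real.exp (-(s : ℝ))) (Real.exp_pos _))
        (mk' hX x (Real.exp (-(t : ℝ))) (Real.exp_pos _)) = dist s t := by
      intro s t
      rw [dist_eq, NNReal.dist_eq]
      simp only [mk', dist_self, zero_add, Real.log_exp]
      rcases le_total s t with hst | hst
      · have hst' : (s : ℝ) ≤ t := by exact_mod_cast hst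
        rw [max_eq_left (Real.exp_le_exp.2 (neg_le_neg hst')), Real.log_exp,
          abs_of_nonpos (by linarith)]
        ring
      · have hst' : (t : ℝ) ≤ s := by exact_mod_cast hst
        rw [max_eq_right (Real.exp_le_exp.2 (neg_le_neg hst')), Real.log_exp,
          abs_of_nonneg (by linarith)]
        ring
    refine ⟨1, one_pos, fun s t => ?_⟩
    rw [h s t]
    constructor <;> linarith

/-- The upward ray `γ_{∞,z}(s) = (z, e^s)`. -/
def upRay (hX : ¬ Bornology.IsBounded (univ : Set X)) (z : X) : RoughRay (HypCone X) where
  toFun s := mk' hX z (Real.exp (s : ℝ)) (Real.exp_pos _)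
  rough := by
    have h : ∀ s t : ℝ≥0, dist (mk' hX z (Real.exp (s : ℝ)) (Real.exp_pos _))
        (mk' hX z (Real.exp (t : ℝ)) (Real.exp_pos _)) = dist s t := by
      intro s t
      rw [dist_eq, NNReal.dist_eq]
      simp only [mk', dist_self, zero_add, Real.log_exp]
      rcases le_total s t with hst | hst
      · have hst' : (s : ℝ) ≤ t := by exact_mod_cast hst
        rw [max_eq_right (Real.exp_le_exp.2 hst'), Real.log_exp, abs_of_nonpos (by linarith)]
        ring
      · have hst' : (t : ℝ) ≤ s := by exact_mod_cast hst
        rw [max_eq_left (Real.exp_le_exp.2 hst'), Real.log_exp, abs_of_nonneg (by linarith)]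
        ring
    refine ⟨1, one_pos, fun s t => ?_⟩
    rw [h s t]
    constructor <;> linarith

/-- The vertical direction `[γ_{∞,z}]` does not depend on `z`. -/
theorem endpoint_upRay_eq (hX : ¬ Bornology.IsBounded (univ : Set X)) (z z' : X) :
    (upRay hX z).endpoint = (upRay hX z').endpoint := by
  have key : ∀ (z z' : X) (s : ℝ≥0), edist (upRay hX z s) (upRay hX z' s) ≤
      ENNReal.ofReal (2 * Real.log (dist z z' + 1)) := by
    intro z z' s
    rw [edist_dist]
    apply ENNReal.ofReal_le_ofReal
    rw [dist_eq]
    simp only [upRay, mk', max_self, Real.log_exp]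
    have hs : (1 : ℝ) ≤ Real.exp s := Real.one_le_exp s.2
    have hd : 0 ≤ dist z z' := dist_nonneg
    have h := Real.log_le_log (by positivity)
      (show dist z z' + Real.exp s ≤ (dist z z' + 1) * Real.exp s by nlinarith)
    rw [Real.log_mul (by positivity) (by positivity), Real.log_exp] at h
    linarith
  refine Quotient.sound (s := roughRaySetoid (HypCone X)) (lt_of_le_of_lt
    (Metric.hausdorffEDist_le_of_mem_edist (r := ENNReal.ofReal (2 * Real.log (dist z z' + 1)))
      ?_ ?_) ENNReal.ofReal_lt_top)
  · rintro _ ⟨s, rfl⟩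
    exact ⟨_, ⟨s, rfl⟩, key z z' s⟩
  · rintro _ ⟨s, rfl⟩
    exact ⟨_, ⟨s, rfl⟩, by rw [dist_comm z z']; exact key z' z s⟩

/-- The map `ι : X ∪ {∞} → ∂_∞ Con(X)`, `x ↦ [γ_x]`, `∞ ↦ [γ_{∞,z}]`. -/
def boundaryMap (hX : ¬ Bornology.IsBounded (univ : Set X)) (z : X) :
    OnePoint X → BoundaryAtInfinity (HypCone X) :=
  fun p => p.elim (upRay hX z).endpoint (fun x => (downRay hX x).endpoint)

end HypCone

end

/-! Everything is read off from `gauge p q = d(x, x') + max t t'`, which satisfies the triangle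
inequality and whose doubled logarithm is the cone distance up to the logarithms of the two heights.
In a Gromov product the heights of the two points cancel, so hyperbolicity is the logarithm of a
Ptolemy-type inequality for four points, valid with factor 4 for anything obeying the triangle
inequality (`gauge_mul_gauge_le`).

For the boundary, the triangle inequality for `gauge` along a rough ray forces the heights either to
grow like `e^t` or to decay like `e^{-t}` (`log_height_dichotomy`). In the first case the ray stays
near an upward ray. In the second its bases form a Cauchy family, and completeness gives the point
`x` whose downward ray it follows (`endpoint_eq_upRay_or`).

For the visual metric take base `e`, so that the exponential undoes the logarithm: the expression
under the limit is `gauge (ξ t) (ζ t)` divided by two factors tending to 1. Its limit is exactly the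
distance of the limit points in `X`. -/

theorem RoughRay.endpoint_eq_iff {Y : Type*} [MetricSpace Y] {ξ ζ : RoughRay Y} :
    ξ.endpoint = ζ.endpoint ↔ Metric.hausdorffEDist (range ξ) (range ζ) < ⊤ :=
  Quotient.eq (r := roughRaySetoid Y)

theorem RoughRay.endpoint_eq_of_dist_le {Y : Type*} [MetricSpace Y] {ξ ζ : RoughRay Y} {R : ℝ}
    (h : ∀ t, dist (ξ t) (ζ t) ≤ R) : ξ.endpoint = ζ.endpoint := by
  refine endpoint_eq_iff.2 (lt_of_le_of_lt
    (Metric.hausdorffEDist_le_of_mem_edist (r := ENNReal.ofReal R) ?_ ?_) ENNReal.ofReal_lt_top)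
  · rintro _ ⟨s, rfl⟩
    exact ⟨_, ⟨s, rfl⟩, by rw [edist_dist]; exact ENNReal.ofReal_le_ofReal (h s)⟩
  · rintro _ ⟨s, rfl⟩
    exact ⟨_, ⟨s, rfl⟩, by rw [edist_comm, edist_dist]; exact ENNReal.ofReal_le_ofReal (h s)⟩

theorem RoughRay.exists_dist_lt_of_endpoint_eq {Y : Type*} [MetricSpace Y] {ξ ζ : RoughRay Y}
    (h : ξ.endpoint = ζ.endpoint) : ∃ R : ℝ, ∀ t, ∃ s, dist (ξ t) (ζ s) < R := by
  have h1 := endpoint_eq_iff.1 h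
  obtain ⟨R, hR, -⟩ := ENNReal.lt_iff_exists_nnreal_btwn.1 h1
  refine ⟨R, fun t => ?_⟩
  obtain ⟨_, ⟨s, rfl⟩, hs⟩ := Metric.exists_edist_lt_of_hausdorffEDist_lt (mem_range_self t) hR
  exact ⟨s, edist_lt_coe.1 hs⟩

/-! ### The gauge, and distances and Gromov products in terms of it -/

namespace HypCone

variable {X : Type*} [MetricSpace X]

/-- The quasi-metric `d(x, x') + max t t'` on `Con(X)` from which its distance is built. -/
def gauge (p q : HypCone X) : ℝ := dist p.base q.base + max p.height q.height

theorem gauge_pos (p q : HypCone X) : 0 < gauge p q :=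
  add_pos_of_nonneg_of_pos dist_nonneg (lt_max_of_lt_left p.height_pos)

theorem gauge_comm (p q : HypCone X) : gauge p q = gauge q p := by
  rw [gauge, gauge, dist_comm, max_comm]

theorem dist_base_le_gauge (p q : HypCone X) : dist p.base q.base ≤ gauge p q :=
  le_add_of_nonneg_right (p.height_pos.le.trans (le_max_left _ _))

theorem gauge_triangle (p q r : HypCone X) : gauge p r ≤ gauge p q + gauge q r := by
  have h1 := dist_triangle p.base q.base r.base
  have h2 : max p.height r.height ≤ max p.height q.height + max q.height r.height :=
    max_le (by linarith [le_max_left p.height q.height, le_max_left q.height r.height, q.height_pos])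
      (by linarith [le_max_right p.height q.height, le_max_right q.height r.height, q.height_pos])
  unfold gauge
  linarith

theorem dist_eq_gauge (p q : HypCone X) :
    dist p q = 2 * Real.log (gauge p q) - Real.log p.height - Real.log q.height :=
  dist_eq p q

/-- Turns bounds on cone distances, such as those of a rough isometry, into bounds on `gauge`, to
which the plain triangle inequality applies. -/
theorem gauge_eq_exp (p q : HypCone X) :
    gauge p q = Real.exp ((dist p q + Real.log p.height + Real.log q.height) / 2) := by
  rw [dist_eq_gauge, ← Real.exp_log (gauge_pos p q), Real.log_exp]
  ring_nf

theorem gromovProduct_eq (x y o : HypCone X) :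
    gromovProduct x y o = Real.log (gauge x o) + Real.log (gauge y o) - Real.log (gauge x y)
      - Real.log o.height := by
  rw [gromovProduct, dist_eq_gauge, dist_eq_gauge, dist_eq_gauge, gauge_comm o y]
  ring

/-! ### Hyperbolicity of the cone -/

/-- In the quadrilateral `x, y, w, o`, each diagonal is at most the smallest side plus one of its
two neighbours, hence at most twice that neighbour. The two neighbours are opposite sides, so their
product is one of the terms of the maximum. The case splits single out the smallest side. -/
theorem gauge_mul_gauge_le (x y w o : HypCone X) :
    gauge x w * gauge y o ≤ 4 * max (gauge x y * gauge w o) (gauge y w * gauge x o) := by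
  have hxy := gauge_pos x y
  have hwo := gauge_pos w o
  have hyw := gauge_pos y w
  have hxo := gauge_pos x o
  have h1 := gauge_triangle x y w
  have h2 := gauge_triangle x o w
  have h3 := gauge_triangle y x o
  have h4 := gauge_triangle y w o
  rw [gauge_comm o w] at h2
  rw [gauge_comm y x] at h3
  have key : ∀ {s t u v : ℝ}, 0 < s → 0 < t → u ≤ 2 * s → v ≤ 2 * t → 0 < v →
      u * v ≤ 4 * (s * t) := fun hs ht hu hv hv' => by
    have := mul_le_mul hu hv hv'.le (by positivity)
    linarith
  have hv := gauge_pos y o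
  rcases le_total (gauge x y) (gauge w o) with a1 | a1 <;>
    rcases le_total (gauge y w) (gauge x o) with a2 | a2
  · rcases le_total (gauge x y) (gauge y w) with a3 | a3
    · refine (key hyw hxo ?_ ?_ hv).trans (by gcongr; exact le_max_right _ _) <;> linarith
    · refine (key hxy hwo ?_ ?_ hv).trans (by gcongr; exact le_max_left _ _) <;> linarith
  · rcases le_total (gauge x y) (gauge x o) with a3 | a3
    · refine (key hyw hxo ?_ ?_ hv).trans (by gcongr; exact le_max_right _ _) <;> linarith
    · have := key hwo hxy (u := gauge x w) (by linarith) (v := gauge y o) (by linarith) hv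
      rw [mul_comm (gauge w o)] at this
      exact this.trans (by gcongr; exact le_max_left _ _)
  · rcases le_total (gauge w o) (gauge y w) with a3 | a3
    · have := key hxo hyw (u := gauge x w) (by linarith) (v := gauge y o) (by linarith) hv
      rw [mul_comm (gauge x o)] at this
      exact this.trans (by gcongr; exact le_max_right _ _)
    · refine (key hxy hwo ?_ ?_ hv).trans (by gcongr; exact le_max_left _ _) <;> linarith
  · rcases le_total (gauge w o) (gauge x o) with a3 | a3
    · have := key hxo hyw (u := gauge x w) (by linarith) (v := gauge y o) (by linarith) hv
      rw [mul_comm (gauge x o)] at this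
      exact this.trans (by gcongr; exact le_max_right _ _)
    · have := key hwo hxy (u := gauge x w) (by linarith) (v := gauge y o) (by linarith) hv
      rw [mul_comm (gauge w o)] at this
      exact this.trans (by gcongr; exact le_max_left _ _)

theorem min_gromovProduct_sub_le (x y w o : HypCone X) :
    min (gromovProduct x y o) (gromovProduct y w o) - Real.log 4 ≤ gromovProduct x w o := by
  have hpos := @gauge_pos X _
  simp only [gromovProduct_eq]
  have h := gauge_mul_gauge_le x y w o
  rcases max_cases (gauge x y * gauge w o) (gauge y w * gauge x o) with hm | hm <;>
    rw [hm.1] at h <;>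
    have hl := Real.log_le_log (mul_pos (hpos _ _) (hpos _ _)) h <;>
    rw [Real.log_mul (hpos _ _).ne' (hpos _ _).ne', Real.log_mul (by norm_num)
      (mul_pos (hpos _ _) (hpos _ _)).ne', Real.log_mul (hpos _ _).ne' (hpos _ _).ne'] at hl
  · refine (sub_le_sub_right (min_le_left _ _) _).trans ?_
    linarith
  · refine (sub_le_sub_right (min_le_right _ _) _).trans ?_
    linarith

theorem dist_mk'_exp (hX : ¬ Bornology.IsBounded (univ : Set X)) (x y : X) (u v : ℝ) :
    dist (mk' hX x (Real.exp u) (Real.exp_pos _)) (mk' hX y (Real.exp v) (Real.exp_pos _)) =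
      2 * Real.log (dist x y + max (Real.exp u) (Real.exp v)) - u - v := by
  rw [dist_eq]
  simp only [mk', Real.log_exp]

theorem dist_mk'_exp_self (hX : ¬ Bornology.IsBounded (univ : Set X)) (x : X) (u v : ℝ) :
    dist (mk' hX x (Real.exp u) (Real.exp_pos _)) (mk' hX x (Real.exp v) (Real.exp_pos _)) =
      |u - v| := by
  rw [dist_mk'_exp, dist_self, zero_add]
  rcases le_total u v with h | h
  · rw [max_eq_right (Real.exp_le_exp.2 h), Real.log_exp, abs_of_nonpos (by linarith)]
    ring
  · rw [max_eq_left (Real.exp_le_exp.2 h), Real.log_exp, abs_of_nonneg (by linarith)]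
    ring

theorem isRoughlyGeodesic (hX : ¬ Bornology.IsBounded (univ : Set X)) :
    IsRoughlyGeodesic (HypCone X) := by
  refine ⟨2 * Real.log 2, by have := Real.log_pos one_lt_two; linarith, fun p q => ?_⟩
  -- The path climbs vertically over `p` to height `M`, jumps over to `q`, and descends; the two
  -- vertical lengths add up to `dist p q`, and `b` is the time of the jump.
  set M := gauge p q with hM
  have hM0 : 0 < M := gauge_pos p q
  have hd : 0 ≤ dist p.base q.base := dist_nonneg
  have hpM : p.height ≤ M := by
    rw [hM, gauge]; linarith [le_max_left p.height q.height]
  have hqM : q.height ≤ M := by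
    rw [hM, gauge]; linarith [le_max_right p.height q.height]
  have hlp := Real.log_le_log p.height_pos hpM
  have hlq := Real.log_le_log q.height_pos hqM
  set b := Real.log M - Real.log p.height with hb
  have hl : dist p q = b + (Real.log M - Real.log q.height) := by
    rw [dist_eq_gauge, hb]; ring
  let f : ℝ → HypCone X := fun s =>
    if s ≤ b then mk' hX p.base (Real.exp (Real.log p.height + s)) (Real.exp_pos _)
    else mk' hX q.base (Real.exp (Real.log q.height + (dist p q - s))) (Real.exp_pos _)
  have hcross : ∀ s t : ℝ, 0 ≤ s → s ≤ b → b < t → t ≤ dist p q →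
      t - s ≤ dist (f s) (f t) ∧ dist (f s) (f t) ≤ t - s + 2 * Real.log 2 := by
    intro s t hs hsb hbt ht
    simp only [f, if_pos hsb, if_neg hbt.not_ge]
    rw [dist_mk'_exp]
    have e1 : p.height ≤ Real.exp (Real.log p.height + s) := by
      rw [← Real.log_le_iff_le_exp p.height_pos]; linarith
    have e2 : q.height ≤ Real.exp (Real.log q.height + (dist p q - t)) := by
      rw [← Real.log_le_iff_le_exp q.height_pos]; linarith
    have e3 : Real.exp (Real.log p.height + s) ≤ M := by
      rw [← Real.le_log_iff_exp_le hM0]; linarith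
    have e4 : Real.exp (Real.log q.height + (dist p q - t)) ≤ M := by
      rw [← Real.le_log_iff_exp_le hM0]; linarith
    -- The gauge of two points on different legs lies between `M` and `2 * M`; this factor 2 is the
    -- whole error `2 * log 2`.
    have e5 := max_le e3 e4
    have e6 := max_le_max e1 e2
    have e7 : dist p.base q.base ≤ M := dist_base_le_gauge p q
    have l1 := Real.log_le_log hM0 (show M ≤ dist p.base q.base + max
      (Real.exp (Real.log p.height + s)) (Real.exp (Real.log q.height + (dist p q - t))) by
        rw [hM, gauge]; linarith)
    have l2 := Real.log_le_log (hM0.trans_le ((Real.log_le_log_iff hM0 (by positivity)).1 l1))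
      (show dist p.base q.base + max (Real.exp (Real.log p.height + s))
        (Real.exp (Real.log q.height + (dist p q - t))) ≤ 2 * M by linarith)
    rw [Real.log_mul two_ne_zero hM0.ne'] at l2
    constructor <;> linarith
  have hle : ∀ s t : ℝ, 0 ≤ s → s ≤ t → t ≤ dist p q →
      t - s ≤ dist (f s) (f t) ∧ dist (f s) (f t) ≤ t - s + 2 * Real.log 2 := by
    intro s t hs hst ht
    have hlog := Real.log_pos one_lt_two
    rcases le_or_gt t b with htb | htb
    · simp only [f, if_pos htb, if_pos (hst.trans htb)]
      rw [dist_mk'_exp_self, abs_of_nonpos (by linarith)]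
      constructor <;> linarith
    · rcases le_or_gt s b with hsb | hsb
      · exact hcross s t hs hsb htb ht
      · simp only [f, if_neg htb.not_ge, if_neg hsb.not_ge]
        rw [dist_mk'_exp_self, abs_of_nonneg (by linarith)]
        constructor <;> linarith
  refine ⟨dist p q, dist_nonneg, fun s => f s, ?_, ?_, ?_⟩
  · rintro ⟨s, hs⟩ ⟨t, ht⟩
    have hlog := Real.log_pos one_lt_two
    rw [Subtype.dist_eq, Real.dist_eq]
    dsimp only
    rcases le_total s t with h | h
    · have := hle s t hs.1 h ht.2
      rw [abs_of_nonpos (by linarith)]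
      constructor <;> linarith [this.1, this.2]
    · have := hle t s ht.1 h hs.2
      rw [abs_of_nonneg (by linarith), dist_comm]
      constructor <;> linarith [this.1, this.2]
  · have hb0 : 0 ≤ b := by linarith
    simp only [f, if_pos hb0]
    exact HypCone.ext rfl (by simp only [mk', add_zero, Real.exp_log p.height_pos])
  -- If there is no descent, the final time falls in the first branch of `f`; then `q` has height
  -- `M`, which forces equal bases.
  · by_cases h : dist p q ≤ b
    · have hMq : M = q.height :=
        Real.log_injOn_pos (mem_Ioi.2 hM0) (mem_Ioi.2 q.height_pos) (by linarith)
      have hd0 : dist p.base q.base = 0 := by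
        have := le_max_right p.height q.height
        rw [hM, gauge] at hMq
        linarith
      simp only [f, if_pos h]
      refine HypCone.ext (dist_eq_zero.1 hd0) ?_
      simp only [mk']
      rw [show Real.log p.height + dist p q = Real.log q.height by linarith,
        Real.exp_log q.height_pos]
    · simp only [f, if_neg h]
      exact HypCone.ext rfl (by simp only [mk', sub_self, add_zero, Real.exp_log q.height_pos])

/-! ### Convergence of rough rays -/

/-- Along a rough ray the heights either increase up to time `s` or decrease from time `s` on. -/
theorem log_height_dichotomy {ξ : ℝ≥0 → HypCone X} {C : ℝ} (hξ : IsRoughIsometry C ξ)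
    {r s t : ℝ≥0} (hrs : r ≤ s) (hst : s ≤ t) :
    Real.log (ξ t).height + t ≤ Real.log (ξ s).height + s + (2 * C + 2 * Real.log 2) ∨
    Real.log (ξ r).height - r ≤ Real.log (ξ s).height - s + (2 * C + 2 * Real.log 2) := by
  have hrs' : (r : ℝ) ≤ s := by exact_mod_cast hrs
  have hst' : (s : ℝ) ≤ t := by exact_mod_cast hst
  have d1 : dist r s = s - r := by rw [NNReal.dist_eq, abs_of_nonpos] <;> linarith
  have d2 : dist s t = t - s := by rw [NNReal.dist_eq, abs_of_nonpos] <;> linarith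
  have d3 : dist r t = t - r := by rw [NNReal.dist_eq, abs_of_nonpos] <;> linarith
  have h1 := (hξ r s).2
  have h2 := (hξ s t).2
  have h3 := (hξ r t).1
  rw [d1] at h1
  rw [d2] at h2
  rw [d3] at h3
  -- If both alternatives fail, the gauges from `r` to `s` and from `s` to `t` are each less than
  -- half of that from `r` to `t`. The `2 * log 2` pays for the halving, the `2 * C` for two uses of
  -- the rough isometry.
  by_contra! hcon
  obtain ⟨c1, c2⟩ := hcon
  have htri := gauge_triangle (ξ r) (ξ s) (ξ t)
  simp only [gauge_eq_exp] at htri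
  set E := (dist (ξ r) (ξ t) + Real.log (ξ r).height + Real.log (ξ t).height) / 2 with hE
  have e1 : Real.exp ((dist (ξ r) (ξ s) + Real.log (ξ r).height + Real.log (ξ s).height) / 2) <
      Real.exp (E - Real.log 2) := Real.exp_lt_exp.2 (by rw [hE]; linarith)
  have e2 : Real.exp ((dist (ξ s) (ξ t) + Real.log (ξ s).height + Real.log (ξ t).height) / 2) <
      Real.exp (E - Real.log 2) := Real.exp_lt_exp.2 (by rw [hE]; linarith)
  have e3 : Real.exp (E - Real.log 2) = Real.exp E / 2 := by
    rw [Real.exp_sub, Real.exp_log two_pos]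
  linarith

theorem abs_log_height_sub_le (p q : HypCone X) :
    |Real.log p.height - Real.log q.height| ≤ dist p q := by
  have hd : 0 ≤ dist p.base q.base := dist_nonneg
  have h1 := Real.log_le_log p.height_pos
    (show p.height ≤ gauge p q by unfold gauge; linarith [le_max_left p.height q.height])
  have h2 := Real.log_le_log q.height_pos
    (show q.height ≤ gauge p q by unfold gauge; linarith [le_max_right p.height q.height])
  rw [dist_eq_gauge, abs_le]
  constructor <;> linarith

theorem abs_log_height_sub_zero_le {ξ : ℝ≥0 → HypCone X} {C : ℝ} (hξ : IsRoughIsometry C ξ)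
    (t : ℝ≥0) : |Real.log (ξ t).height - Real.log (ξ 0).height| ≤ t + C := by
  have h := (hξ t 0).2
  rw [NNReal.dist_eq, NNReal.coe_zero, sub_zero, NNReal.abs_eq] at h
  exact (abs_log_height_sub_le _ _).trans h

/-- If `ξ` stays within the descending horoball profile, then it converges exponentially fast to a
point of `X`. -/
theorem exists_limit_of_descending [CompleteSpace X] {ξ : ℝ≥0 → HypCone X} {C B : ℝ}
    (hξ : IsRoughIsometry C ξ) (hB : ∀ t, Real.log (ξ t).height + t ≤ B) :
    ∃ x : X, ∀ t : ℝ≥0, dist (ξ t).base x ≤ Real.exp (C / 2 + B) * Real.exp (-(t : ℝ)) := by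
  -- In the exponent `(dist + log height + log height) / 2` the growth `t - s` of the distance is
  -- cancelled by the height bound `B - t`, leaving `C / 2 + B - s`, uniformly in `t`.
  have hd : ∀ s t : ℝ≥0, s ≤ t →
      dist (ξ s).base (ξ t).base ≤ Real.exp (C / 2 + B) * Real.exp (-(s : ℝ)) := by
    intro s t hst
    have hst' : (s : ℝ) ≤ t := by exact_mod_cast hst
    have h := (hξ s t).2
    rw [NNReal.dist_eq, abs_of_nonpos (by linarith)] at h
    calc dist (ξ s).base (ξ t).base ≤ gauge (ξ s) (ξ t) :=
          dist_base_le_gauge _ _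
      _ ≤ Real.exp (C / 2 + B + -(s : ℝ)) := by
          rw [gauge_eq_exp]
          exact Real.exp_le_exp.2 (by linarith [hB s, hB t])
      _ = _ := Real.exp_add _ _
  have hlim : Tendsto (fun s : ℝ≥0 => Real.exp (-(s : ℝ))) atTop (𝓝 0) :=
    Real.tendsto_exp_neg_atTop_nhds_zero.comp (NNReal.tendsto_coe_atTop.2 tendsto_id)
  have hcau : CauchySeq fun t => (ξ t).base := by
    refine cauchySeq_of_le_tendsto_0
      (fun s : ℝ≥0 => 2 * Real.exp (C / 2 + B) * Real.exp (-(s : ℝ))) (fun n m N hn hm => ?_) ?_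
    · have := dist_triangle_left (ξ n).base (ξ m).base (ξ N).base
      linarith [hd N n hn, hd N m hm]
    · simpa using hlim.const_mul (2 * Real.exp (C / 2 + B))
  obtain ⟨x, hx⟩ := cauchySeq_tendsto_of_complete hcau
  exact ⟨x, fun t => le_of_tendsto (tendsto_const_nhds.dist hx)
    ((eventually_ge_atTop t).mono fun s hs => hd t s hs)⟩

/-- A rough ray either converges to the vertical direction, or it converges exponentially fast to a
point of `X`. -/
theorem endpoint_eq_upRay_or [CompleteSpace X] (hX : ¬ Bornology.IsBounded (univ : Set X)) (z : X)
    (ξ : RoughRay (HypCone X)) :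
    ξ.endpoint = (upRay hX z).endpoint ∨ ∃ x : X, ξ.endpoint = (downRay hX x).endpoint ∧
      ∃ A : ℝ, ∀ t : ℝ≥0, dist (ξ t).base x ≤ A * Real.exp (-(t : ℝ)) ∧
        (ξ t).height ≤ A * Real.exp (-(t : ℝ)) := by
  obtain ⟨C, -, hξ⟩ := ξ.rough
  set u : ℝ≥0 → ℝ := fun t => Real.log (ξ t).height with hu
  have hexp : ∀ t, (ξ t).height = Real.exp (u t) := fun t => (Real.exp_log (ξ t).height_pos).symm
  have hu0 : ∀ t : ℝ≥0, u t ≤ u 0 + t + C ∧ u 0 - t - C ≤ u t := fun t => by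
    have := abs_le.1 (abs_log_height_sub_zero_le hξ t)
    constructor <;> linarith [this.1, this.2]
  -- Does the descending alternative of the dichotomy hold from some time `s` on against all later
  -- times?
  by_cases hcase : ∃ s : ℝ≥0, ∀ t, s ≤ t → u t + t ≤ u s + s + (2 * C + 2 * Real.log 2)
  · right
    obtain ⟨s, hs⟩ := hcase
    obtain ⟨B, hB⟩ : ∃ B : ℝ, ∀ t, u t + t ≤ B := by
      refine ⟨max (u s + s + (2 * C + 2 * Real.log 2)) (u 0 + 2 * s + C), fun t => ?_⟩
      rcases le_total s t with h | h
      · exact (hs t h).trans (le_max_left _ _)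
      · have h' : (t : ℝ) ≤ s := by exact_mod_cast h
        exact le_trans (by linarith [(hu0 t).1]) (le_max_right _ _)
    obtain ⟨x, hx⟩ := exists_limit_of_descending hξ hB
    have hh : ∀ t : ℝ≥0, (ξ t).height ≤ Real.exp B * Real.exp (-(t : ℝ)) := fun t => by
      rw [hexp, ← Real.exp_add]
      exact Real.exp_le_exp.2 (by linarith [hB t])
    refine ⟨x, ?_, Real.exp (C / 2 + B) + Real.exp B, fun t => ⟨?_, ?_⟩⟩
    · refine RoughRay.endpoint_eq_of_dist_le
        (R := 2 * Real.log (Real.exp (C / 2 + B) + (Real.exp B + 1)) - u 0 + C) fun t => ?_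
      -- The gauge is `O(e^{-t})` and both heights are at least a constant times `e^{-t}`, so `t`
      -- cancels in the distance.
      have hg : gauge (ξ t) (downRay hX x t) ≤
          (Real.exp (C / 2 + B) + (Real.exp B + 1)) * Real.exp (-(t : ℝ)) := by
        have hm : max (ξ t).height (Real.exp (-(t : ℝ))) ≤
            (Real.exp B + 1) * Real.exp (-(t : ℝ)) := by
          have := Real.exp_pos (-(t : ℝ))
          have := mul_pos (Real.exp_pos B) this
          exact max_le (by linarith [hh t]) (by linarith)
        rw [add_mul]
        exact add_le_add (hx t) hm
      have hl := Real.log_le_log (gauge_pos _ _) hg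
      rw [Real.log_mul (by positivity) (by positivity), Real.log_exp] at hl
      have hlog : Real.log (downRay hX x t).height = -t := Real.log_exp _
      rw [dist_eq_gauge, hlog]
      linarith [(hu0 t).2]
    · refine (hx t).trans ?_
      gcongr
      linarith [Real.exp_pos B]
    · refine (hh t).trans ?_
      gcongr
      linarith [Real.exp_pos (C / 2 + B)]
  · left
    push Not at hcase
    -- Every `s` has a later `t` violating the first alternative, so the second holds with `r = 0`:
    -- the heights grow at least like `e^s`.
    have hup : ∀ s : ℝ≥0, u 0 ≤ u s - s + (2 * C + 2 * Real.log 2) := fun s => by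
      obtain ⟨t, hst, ht⟩ := hcase s
      have := (log_height_dichotomy hξ zero_le hst).resolve_left (not_le.2 ht)
      simpa using this
    set A := dist (ξ 0).base z + Real.exp (u 0 + C) + (Real.exp (u 0 + C) + 1) with hA
    refine RoughRay.endpoint_eq_of_dist_le
      (R := 2 * Real.log A - u 0 + (2 * C + 2 * Real.log 2)) fun t => ?_
    have hg : gauge (ξ t) (upRay hX z t) ≤ A * Real.exp t := by
      have h1 : dist (ξ t).base (ξ 0).base ≤ Real.exp (u 0 + C) * Real.exp t := by
        have h := (hξ t 0).2
        rw [NNReal.dist_eq, NNReal.coe_zero, sub_zero, NNReal.abs_eq] at h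
        refine (dist_base_le_gauge _ _).trans ?_
        rw [gauge_eq_exp, ← Real.exp_add]
        exact Real.exp_le_exp.2 (by linarith [(hu0 t).1])
      have h2 : max (ξ t).height (Real.exp (t : ℝ)) ≤ (Real.exp (u 0 + C) + 1) * Real.exp t := by
        have h3 : (ξ t).height ≤ Real.exp (u 0 + C) * Real.exp t := by
          rw [hexp, ← Real.exp_add]
          exact Real.exp_le_exp.2 (by linarith [(hu0 t).1])
        have := Real.exp_pos (t : ℝ)
        have := mul_pos (Real.exp_pos (u 0 + C)) this
        exact max_le (by linarith) (by linarith)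
      have h4 := dist_triangle (ξ t).base (ξ 0).base z
      have h5 : dist (ξ 0).base z ≤ dist (ξ 0).base z * Real.exp t :=
        le_mul_of_one_le_right dist_nonneg (Real.one_le_exp t.2)
      have h6 : gauge (ξ t) (upRay hX z t) = dist (ξ t).base z + max (ξ t).height (Real.exp t) :=
        rfl
      rw [h6, hA, add_mul, add_mul]
      linarith
    have hA0 : 0 < A := by positivity
    have hl := Real.log_le_log (gauge_pos _ _) hg
    rw [Real.log_mul hA0.ne' (by positivity), Real.log_exp] at hl
    have hlog : Real.log (upRay hX z t).height = t := Real.log_exp _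
    rw [dist_eq_gauge, hlog]
    linarith [hup t]

/-! ### The boundary map -/

/-- The logarithm of the height is 1-Lipschitz; it is nonnegative on the upward ray and tends to
`-∞` on the downward one. -/
theorem endpoint_downRay_ne_upRay (hX : ¬ Bornology.IsBounded (univ : Set X)) (x z : X) :
    (downRay hX x).endpoint ≠ (upRay hX z).endpoint := by
  intro h
  obtain ⟨R, hR⟩ := RoughRay.exists_dist_lt_of_endpoint_eq h
  obtain ⟨s, hs⟩ := hR R.toNNReal
  have h1 := (le_abs_self _).trans (abs_log_height_sub_le (upRay hX z s) (downRay hX x R.toNNReal))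
  have h2 : Real.log (upRay hX z s).height = s := Real.log_exp _
  have h3 : Real.log (downRay hX x R.toNNReal).height = -(R.toNNReal : ℝ) := Real.log_exp _
  rw [h2, h3, dist_comm] at h1
  linarith [s.2, Real.le_coe_toNNReal R]

theorem endpoint_downRay_injective (hX : ¬ Bornology.IsBounded (univ : Set X)) :
    Function.Injective fun x : X => (downRay hX x).endpoint := by
  intro x y h
  by_contra hxy
  obtain ⟨R, hR⟩ := RoughRay.exists_dist_lt_of_endpoint_eq h
  -- At time `T` the distance to any point of the other ray is at least `2 * log (dist x y) + T =
  -- R`.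
  set T := R - 2 * Real.log (dist x y) with hT
  obtain ⟨s, hs⟩ := hR T.toNNReal
  have h2 : Real.log (downRay hX y s).height = -s := Real.log_exp _
  have h3 : Real.log (downRay hX x T.toNNReal).height = -(T.toNNReal : ℝ) := Real.log_exp _
  have h4 : Real.log (dist x y) ≤ Real.log (gauge (downRay hX x T.toNNReal) (downRay hX y s)) :=
    Real.log_le_log (dist_pos.2 hxy)
      (dist_base_le_gauge (downRay hX x T.toNNReal) (downRay hX y s))
  rw [dist_eq_gauge, h2, h3] at hs
  linarith [s.2, Real.le_coe_toNNReal T]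

theorem boundaryMap_bijective [CompleteSpace X] (hX : ¬ Bornology.IsBounded (univ : Set X))
    (z : X) : Function.Bijective (boundaryMap hX z) := by
  constructor
  · intro p q h
    induction p using OnePoint.rec <;> induction q using OnePoint.rec
    · rfl
    · exact absurd h.symm (endpoint_downRay_ne_upRay hX _ z)
    · exact absurd h (endpoint_downRay_ne_upRay hX _ z)
    · exact congrArg _ (endpoint_downRay_injective hX h)
  · intro b
    induction b using Quotient.inductionOn with
    | h ξ =>
      rcases endpoint_eq_upRay_or hX z ξ with h | ⟨x, h, -⟩
      · exact ⟨OnePoint.infty, h.symm⟩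
      · exact ⟨x, h.symm⟩

/-- The identification of `X` with the boundary of `Con(X)` punctured at the vertical direction. -/
noncomputable def puncturedBoundaryEquiv [CompleteSpace X] (hX : ¬ Bornology.IsBounded (univ : Set X)) (z : X) :
    X ≃ PuncturedBoundary (upRay hX z) :=
  Equiv.ofBijective (fun x => ⟨(downRay hX x).endpoint, endpoint_downRay_ne_upRay hX x z⟩) <| by
    constructor
    · exact fun x y h => endpoint_downRay_injective hX (congrArg Subtype.val h)
    · rintro ⟨b, hb⟩
      induction b using Quotient.inductionOn with
      | h ξ =>
        rcases endpoint_eq_upRay_or hX z ξ with h | ⟨x, h, -⟩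
        · exact absurd h hb
        · exact ⟨x, Subtype.ext h.symm⟩

/-- Holds for every representative of the boundary point, which makes the visual limit independent
of the chosen rays. -/
theorem exists_tendsto_of_endpoint_ne [CompleteSpace X]
    (hX : ¬ Bornology.IsBounded (univ : Set X)) (z : X) (ξ : RoughRay (HypCone X))
    (hξ : ξ.endpoint ≠ (upRay hX z).endpoint) :
    Tendsto (fun t => (ξ t).base) atTop
      (𝓝 ((puncturedBoundaryEquiv hX z).symm ⟨ξ.endpoint, hξ⟩)) ∧
    Tendsto (fun t => (ξ t).height) atTop (𝓝 0) := by
  obtain ⟨x, hx, A, hA⟩ := (endpoint_eq_upRay_or hX z ξ).resolve_left hξ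
  have hex : (puncturedBoundaryEquiv hX z).symm ⟨ξ.endpoint, hξ⟩ = x :=
    (Equiv.symm_apply_eq _).2 (Subtype.ext hx)
  rw [hex]
  have hlim : Tendsto (fun s : ℝ≥0 => A * Real.exp (-(s : ℝ))) atTop (𝓝 0) := by
    simpa using (Real.tendsto_exp_neg_atTop_nhds_zero.comp
      (NNReal.tendsto_coe_atTop.2 tendsto_id)).const_mul A
  exact ⟨tendsto_iff_dist_tendsto_zero.2
      (squeeze_zero (fun _ => dist_nonneg) (fun t => (hA t).1) hlim),
    squeeze_zero (fun t => (ξ t).height_pos.le) (fun t => (hA t).2) hlim⟩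

/-! ### The parabolic visual metric -/

/-- The base distance and the height of `ξ t` converge, so the height `e^t` of the upward ray
dominates the gauge. -/
theorem tendsto_exp_neg_mul_gauge_upRay (hX : ¬ Bornology.IsBounded (univ : Set X)) (z : X)
    {ξ : ℝ≥0 → HypCone X} {x : X} (hb : Tendsto (fun t => (ξ t).base) atTop (𝓝 x))
    (hh : Tendsto (fun t => (ξ t).height) atTop (𝓝 0)) :
    Tendsto (fun t : ℝ≥0 => Real.exp (-(t : ℝ)) * gauge (ξ t) (upRay hX z t)) atTop (𝓝 1) := by
  have he : Tendsto (fun s : ℝ≥0 => Real.exp (-(s : ℝ))) atTop (𝓝 0) :=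
    Real.tendsto_exp_neg_atTop_nhds_zero.comp (NNReal.tendsto_coe_atTop.2 tendsto_id)
  have h := (he.mul (hb.dist (tendsto_const_nhds (x := z)))).add
    ((he.mul hh).max (tendsto_const_nhds (x := (1 : ℝ))))
  rw [zero_mul, zero_mul, max_eq_right zero_le_one, zero_add] at h
  refine h.congr fun t => ?_
  have h1 : gauge (ξ t) (upRay hX z t) = dist (ξ t).base z + max (ξ t).height (Real.exp t) := rfl
  rw [h1, mul_add, mul_max_of_nonneg _ _ (Real.exp_pos _).le, ← Real.exp_add, neg_add_cancel,
    Real.exp_zero]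

/-- The explicit `t` and the logarithmic height `t` of the base point supply one factor `e^{-t}` for
each gauge in the denominator. -/
theorem exp_sub_gromovProduct_upRay (hX : ¬ Bornology.IsBounded (univ : Set X)) (z : X)
    (p q : HypCone X) (t : ℝ≥0) :
    Real.exp 1 ^ ((t : ℝ) - gromovProduct p q (upRay hX z t)) =
      gauge p q / ((Real.exp (-(t : ℝ)) * gauge p (upRay hX z t)) *
        (Real.exp (-(t : ℝ)) * gauge q (upRay hX z t))) := by
  have hlog : Real.log (upRay hX z t).height = t := Real.log_exp _
  rw [Real.exp_one_rpow, gromovProduct_eq, hlog,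
    ← Real.exp_log (div_pos (gauge_pos p q) (mul_pos (mul_pos (Real.exp_pos _) (gauge_pos _ _))
      (mul_pos (Real.exp_pos _) (gauge_pos _ _))))]
  have h1 := (gauge_pos p q).ne'
  have h2 := (gauge_pos p (upRay hX z t)).ne'
  have h3 := (gauge_pos q (upRay hX z t)).ne'
  have h4 := (Real.exp_pos (-(t : ℝ))).ne'
  rw [Real.log_div h1 (by positivity), Real.log_mul (by positivity) (by positivity),
    Real.log_mul h4 h2, Real.log_mul h4 h3, Real.log_exp]
  ring_nf

/-- With base `e`, the parabolic visual quasimetric of the vertical direction is the metric of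
`X`. -/
theorem isParabolicVisualQuasimetric_dist [CompleteSpace X]
    (hX : ¬ Bornology.IsBounded (univ : Set X)) (z : X) :
    IsParabolicVisualQuasimetric (upRay hX z) (Real.exp 1) fun u v =>
      dist ((puncturedBoundaryEquiv hX z).symm u) ((puncturedBoundaryEquiv hX z).symm v) := by
  intro ξ ζ hξ hζ
  obtain ⟨b1, h1⟩ := exists_tendsto_of_endpoint_ne hX z ξ hξ
  obtain ⟨b2, h2⟩ := exists_tendsto_of_endpoint_ne hX z ζ hζ
  simp only [exp_sub_gromovProduct_upRay]
  -- The numerator tends to the distance of the limits plus `max 0 0`, the denominator to `1 * 1`.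
  have h := ((b1.dist b2).add (h1.max h2)).div
    ((tendsto_exp_neg_mul_gauge_upRay hX z b1 h1).mul
      (tendsto_exp_neg_mul_gauge_upRay hX z b2 h2)) (by norm_num)
  simpa [gauge, Pi.div_def] using h

end HypCone

theorem mainTheorem7 {X : Type*} [MetricSpace X] [CompleteSpace X]
    (hX : ¬ Bornology.IsBounded (univ : Set X))
    (a : ℝ) (ha : 1 < a) (α : Equiv.Perm X) (hα : ∀ x y : X, dist (α x) (α y) = a * dist x y)
    (K : Set X) (hK : IsCompact K) (hcover : ⋃ n : ℤ, (α ^ n) '' K = univ)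
    (x₀ : X) (hfix : α x₀ = x₀) (hx₀ : x₀ ∈ interior K) (z : X) :
    IsGromovHyperbolic (HypCone X) ∧
    Function.Bijective (HypCone.boundaryMap hX z) ∧
    ∃ e : X ≃ PuncturedBoundary (HypCone.upRay hX z),
      (∀ x : X, (e x : BoundaryAtInfinity (HypCone X)) = HypCone.boundaryMap hX z (x : OnePoint X)) ∧
      IsParabolicVisualMetric (HypCone.upRay hX z)
        (MetricSpace.induced e.symm e.symm.injective ‹MetricSpace X›) := by
  -- The quasimetric with base `e` equals the transported metric, so `L = 1` works.
  refine ⟨⟨HypCone.isRoughlyGeodesic hX, Real.log 4, Real.log_nonneg (by norm_num),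
    HypCone.min_gromovProduct_sub_le⟩, HypCone.boundaryMap_bijective hX z,
    HypCone.puncturedBoundaryEquiv hX z, fun x => rfl, Real.exp 1, Real.one_lt_exp_iff.2 one_pos,
    _, HypCone.isParabolicVisualQuasimetric_dist hX z, 1, le_rfl, fun u v => ?_⟩
  rw [inv_one, one_mul]
  exact ⟨le_rfl, le_rfl⟩
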